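/- A lattice path is a finite sequence of steps $\mathsf{E}=(1,0)$, $\mathsf{N}=(0,1)$, $\mathsf{D}=(1,1)$. For integers $\alpha\ge 1$ and $n\ge 0$ let $\mathcal{S}_n(\alpha)$ be the set of lattice paths from $(0,0)$ to $(n,\alpha n)$ that stay weakly above the line $y=\alpha x$ (rational Schröder paths of slope $\alpha$). For $j\ge 1$ let $\mathcal{SP}^\wedge_j$ be the set of Schröder paths in $\mathcal{S}_j(1)$ that lie strictly above the diagonal $y=x$ except at their two endpoints, where for $j=1$ the single step $\mathsf{D}$ is also included; put $\sigma_j=\#\mathcal{SP}^\wedge_j$. For $a\ge 0$ and a sequence $\mathbf{c}=(c_1,c_2,\dots)$ of non-negative integers let $\mathfrak{D}^{\mathbf{c}}_n(a,1)$ be the set of Dyck words of semilength $(a+1)n$ that are concatenations of strings $d$ and $u^{(a+1)j}d^{j}$ $(1\le j\le n)$, in which each maximal ascent $u^{(a+1)j}$ is colored in one of $c_j$ ways. Denote by $(s_m)_{m\ge 0}=1,1,3,11,45,\dots$ the little Schröder numbers. **Theorem.** For all integers $\alpha\ge 1$ and $n\ge 0$, the sets $\mathcal{S}_n(\alpha)$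 and $\mathfrak{D}^{\boldsymbol\sigma}_n(\alpha-1,1)$ are finite and $$\#\mathcal{S}_n(\alpha)=\#\mathfrak{D}^{\boldsymbol\sigma}_n(\alpha-1,1),$$ where $\mathcal{SP}^\wedge_j$ is finite and $\sigma_j=2s_{j-1}$ for every $j\ge 1$. Moreover, when the colors of an ascent $u^{\alpha j}$ are taken to be the paths in $\mathcal{SP}^\wedge_j$, the following map $\xi$ is a bijection from $\mathcal{S}_n(\alpha)$ to $\mathfrak{D}^{\boldsymbol\sigma}_n(\alpha-1,1)$. Given $p\in\mathcal{S}_n(\alpha)$, walk along $p$ backwards from $(n,\alpha n)$ to $(0,0)$ and write the colored word $\xi(p)$ from left to right; at the current point $(x,y)$ of $p$: - if the step of $p$ ending at $(x,y)$ is $\mathsf{D}$, append $u^{\alpha}d$ with the ascent colored by the path $\mathsf{D}$, and move to $(x-1,y-1)$; - if it is $\mathsf{N}$, append $d$ and move to $(x,y-1)$; - if it is $\mathsf{E}$, let $(x-j,y-j)$, $j\ge 1$, be the next point, going backwards, at which $p$ meets the line of slope $1$ through $(x,y)$; append $u^{\alpha j}d^{j}$ with the ascent colored by the part of $p$ between $(x-j,y-j)$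 and $(x,y)$ (translated to start at the origin), and move to $(x-j,y-j)$. -/

import Mathlib

namespace RationalSchroder

/-- The three kinds of steps: east `E = (1,0)`, north `N = (0,1)`, diagonal `D = (1,1)`. -/
inductive Step
  | E
  | N
  | D
  deriving DecidableEq

/-- A lattice path starting at `(0,0)` is the list of its steps; `xCoord p` is the first
coordinate of its endpoint. -/
def xCoord (p : List Step) : ℕ := p.count Step.E + p.count Step.D

/-- The second coordinate of the endpoint of a lattice path starting at `(0,0)`. -/
def yCoord (p : List Step) : ℕ := p.count Step.N + p.count Step.D

/-- The rational Schröder paths of slope `α`: the paths from `(0,0)` to `(n, α n)` that stay weakly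
above the line `y = α x`. The lattice points visited are the endpoints of the prefixes, and a step
between two points of the half-plane `α x ≤ y` stays inside that half-plane. -/
def schroderPaths (α n : ℕ) : Set (List Step) :=
  {p | xCoord p = n ∧ yCoord p = α * n ∧ ∀ q, q <+: p → α * xCoord q ≤ yCoord q}

/-- The (classical, slope `1`) Schröder paths from `(0,0)` to `(n,n)` that, apart from their
endpoints, lie strictly above the diagonal `y = x`, together with the single diagonal step
when `n = 1`. -/
def strictPaths (n : ℕ) : Set (List Step) :=
  {p | p ∈ schroderPaths 1 n ∧
    (p = [Step.D] ∨ ∀ q, q <+: p → q ≠ [] → q ≠ p → xCoord q < yCoord q)}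

/-- The sequence `σ` enumerating the strict Schröder paths. -/
noncomputable def sigma (j : ℕ) : ℕ := (strictPaths j).ncard

/-- The little Schröder numbers `1, 1, 3, 11, 45, …`, indexed from `0`. Mathlib's
`Nat.smallSchroder` is the sequence `1, 1, 1, 3, 11, 45, …`, that is, shifted by one. -/
def littleSchroder (m : ℕ) : ℕ := Nat.smallSchroder (m + 1)

/-- The string `u^{(a+1) j} d^j`. -/
def block (a j : ℕ) : List DyckStep :=
  List.replicate ((a + 1) * j) DyckStep.U ++ List.replicate j DyckStep.D

/-- The Dyck words of semilength `(a+1) n` that are concatenations of strings, each of which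
is either `d` or `u^{(a+1) j} d^j` with `1 ≤ j ≤ n`. -/
def blockDyckWords (a n : ℕ) : Set (List DyckStep) :=
  {w | (∃ W : DyckWord, W.toList = w ∧ W.semilength = (a + 1) * n) ∧
    ∃ bs : List (List DyckStep),
      (∀ b ∈ bs, b = [DyckStep.D] ∨ ∃ j, 1 ≤ j ∧ j ≤ n ∧ b = block a j) ∧ w = bs.flatten}

/-- The lengths, from left to right, of the maximal ascents of a word, i.e. of the maximal
nonempty runs of `u`'s (cut the word at every `d` and discard the empty pieces). -/
def ascentLengths (w : List DyckStep) : List ℕ :=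
  ((w.splitOn DyckStep.D).map List.length).filter (fun l => 0 < l)

/-- The colored Dyck words: pairs of a word of `blockDyckWords a n` and the list of the colors of
its maximal ascents, from left to right, where an ascent of length `(a+1) j` gets a color from
the set `C j`. -/
def coloredDyckWords {κ : Type*} (C : ℕ → Set κ) (a n : ℕ) : Set (List DyckStep × List κ) :=
  {q | q.1 ∈ blockDyckWords a n ∧
    List.Forall₂ (fun l c => ∃ j, l = (a + 1) * j ∧ c ∈ C j) (ascentLengths q.1) q.2}

/-- The colored Dyck words in which an ascent of length `(a+1) j` may be colored in `c j` different
ways. -/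
def numColoredDyckWords (c : ℕ → ℕ) (a n : ℕ) : Set (List DyckStep × List ℕ) :=
  coloredDyckWords (fun j => {i | i < c j}) a n

/-- Walk a path backwards, given by the list of its steps in reverse order, from a point that lies
`h` above a line of slope `1`, up to the first point on that line. Returns the steps walked and
the remaining ones, both in reverse order. -/
def cut : ℕ → List Step → List Step × List Step
  | 0, r => ([], r)
  | _ + 1, [] => ([], [])
  | h + 1, Step.E :: r => (Step.E :: (cut (h + 2) r).1, (cut (h + 2) r).2)
  | h + 1, Step.N :: r => (Step.N :: (cut h r).1, (cut h r).2)
  | h + 1, Step.D :: r => (Step.D :: (cut (h + 1) r).1, (cut (h + 1) r).2)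

theorem length_cut_le (h : ℕ) (r : List Step) : (cut h r).2.length ≤ r.length := by
  induction r generalizing h with
  | nil => cases h <;> simp [cut]
  | cons s r ih =>
    cases h with
    | zero => simp [cut]
    | succ h => cases s <;> simp only [cut, List.length_cons] <;> exact (ih _).trans (Nat.le_succ _)

/-- The map `ξ` on a path that is given by the list of its steps in reverse order.
A step `D` contributes the block `u^α d` with color `D`; a step `N` contributes a single `d`;
for a step `E`, the piece `p` of the path back to the first point on the line of slope `1` through
the current point contributes `u^{α j} d^j` with color `p`, where `j` is the horizontal extent
of `p`. -/
def xiRev (α : ℕ) : List Step → List DyckStep × List (List Step)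
  | [] => ([], [])
  | Step.D :: r =>
    (List.replicate α DyckStep.U ++ DyckStep.D :: (xiRev α r).1, [Step.D] :: (xiRev α r).2)
  | Step.N :: r => (DyckStep.D :: (xiRev α r).1, (xiRev α r).2)
  | Step.E :: r =>
    let p := (Step.E :: (cut 1 r).1).reverse
    let j := xCoord p
    (List.replicate (α * j) DyckStep.U ++ List.replicate j DyckStep.D ++ (xiRev α (cut 1 r).2).1,
      p :: (xiRev α (cut 1 r).2).2)
termination_by r => r.length
decreasing_by
  all_goals have := length_cut_le 1 r
  all_goals simp only [List.length_cons]; omega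

/-- The map `ξ`: walk the path from its endpoint back to `(0,0)` and write the colored Dyck word
from left to right. -/
def xi (α : ℕ) (p : List Step) : List DyckStep × List (List Step) := xiRev α p.reverse

end RationalSchroder

/-!
Walking a path backwards and cutting it along lines of slope `1` decomposes every path that stays
weakly above the diagonal, in a unique way, into single steps `N` and strict paths, and `ξ` merely
encodes this list of pieces. A piece changes the height `y - α x` by minus the amount by which its
word changes the excess of `u`'s over `d`'s. Since the path ends at height `0` and is read
backwards, its height at a cut point is the excess of the word written so far. Neither quantity
has its minimum in the interior of a piece, so the path stays weakly above the line if and only if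
the word is a Dyck word.

A strict path other than `D` is `N q E` for a Schröder path `q`, and cutting a Schröder path of
slope `1` at its last return to the diagonal gives the recursion of the large Schröder numbers.
-/

namespace RationalSchroder

open List

theorem forall_prefix_append_iff {β : Type*} {l m : List β} {P : List β → Prop} :
    (∀ q, q <+: l ++ m → P q) ↔ (∀ q, q <+: l → P q) ∧ ∀ q, q <+: m → P (l ++ q) := by
  refine ⟨fun h ↦ ⟨fun q hq ↦ h q (hq.trans (prefix_append l m)),
    fun q hq ↦ h _ ((prefix_append_right_inj l).2 hq)⟩, fun ⟨hl, hm⟩ q hq ↦ ?_⟩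
  rcases prefix_or_prefix_of_prefix hq (prefix_append l m) with hql | ⟨r, rfl⟩
  · exact hl q hql
  · exact hm r ((prefix_append_right_inj l).1 hq)

theorem forall_prefix_flatMap_nonneg_iff {ι β G : Type*} [AddMonoid G] [Preorder G] [AddLeftMono G]
    {h : List β → G} (h_append : ∀ l m, h (l ++ m) = h l + h m) {b : ι → List β}
    (hb : ∀ i q, q <+: b i → 0 ≤ h q ∨ h (b i) ≤ h q) (L : List ι) :
    (∀ q, q <+: L.flatMap b → 0 ≤ h q) ↔ ∀ M, M <+: L → 0 ≤ h (M.flatMap b) := by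
  induction L using List.reverseRecOn with
  | nil => simp
  | append_singleton L i ih =>
    simp only [flatMap_append, flatMap_singleton, forall_prefix_append_iff, ih, prefix_concat_iff,
      forall_eq_or_imp]
    rw [and_comm]
    refine and_congr_left fun hL ↦ ⟨fun hi ↦ hi _ prefix_rfl, fun hi q hq ↦ ?_⟩
    rw [h_append] at hi ⊢
    rcases hb i q hq with hq | hq
    · exact add_nonneg (hL L prefix_rfl) hq
    · exact hi.trans (add_le_add_right hq _)

theorem forall_proper_prefix_concat_iff {β : Type*} {s : List β} {e : β} {P : List β → Prop} :
    (∀ q, q <+: s ++ [e] → q ≠ [] → q ≠ s ++ [e] → P q) ↔ ∀ q, q <+: s → q ≠ [] → P q := by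
  refine ⟨fun h q hq hne ↦ h q (hq.trans (prefix_append s [e])) hne ?_, fun h q hq hne hne' ↦
    h q ((prefix_concat_iff.1 hq).resolve_left hne') hne⟩
  rintro rfl
  simpa using hq.length_le

/-! ### Coordinates -/

@[simp] theorem xCoord_nil : xCoord [] = 0 := rfl

@[simp] theorem yCoord_nil : yCoord [] = 0 := rfl

@[simp] theorem xCoord_append (p q : List Step) : xCoord (p ++ q) = xCoord p + xCoord q := by
  simp only [xCoord, count_append]; omega

@[simp] theorem yCoord_append (p q : List Step) : yCoord (p ++ q) = yCoord p + yCoord q := by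
  simp only [yCoord, count_append]; omega

@[simp] theorem xCoord_reverse (p : List Step) : xCoord p.reverse = xCoord p := by simp [xCoord]

@[simp] theorem yCoord_reverse (p : List Step) : yCoord p.reverse = yCoord p := by simp [yCoord]

@[simp] theorem xCoord_cons_E (p : List Step) : xCoord (Step.E :: p) = xCoord p + 1 := by
  simp [xCoord]; omega

@[simp] theorem xCoord_cons_N (p : List Step) : xCoord (Step.N :: p) = xCoord p := by
  simp [xCoord]

@[simp] theorem xCoord_cons_D (p : List Step) : xCoord (Step.D :: p) = xCoord p + 1 := by
  simp [xCoord]; omega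

@[simp] theorem yCoord_cons_E (p : List Step) : yCoord (Step.E :: p) = yCoord p := by
  simp [yCoord]

@[simp] theorem yCoord_cons_N (p : List Step) : yCoord (Step.N :: p) = yCoord p + 1 := by
  simp [yCoord]; omega

@[simp] theorem yCoord_cons_D (p : List Step) : yCoord (Step.D :: p) = yCoord p + 1 := by
  simp [yCoord]; omega

theorem xCoord_le_of_sublist {p q : List Step} (h : p <+ q) : xCoord p ≤ xCoord q :=
  Nat.add_le_add (h.count_le _) (h.count_le _)

theorem length_le_xCoord_add_yCoord (p : List Step) : p.length ≤ xCoord p + yCoord p := by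
  induction p with
  | nil => simp
  | cons s p ih => cases s <;> simp <;> omega

instance : Fintype Step := ⟨{Step.E, Step.N, Step.D}, fun s ↦ by cases s <;> simp⟩

theorem finite_schroderPaths (α n : ℕ) : (schroderPaths α n).Finite := by
  refine (List.finite_length_le Step (n + α * n)).subset fun p ⟨hx, hy, _⟩ ↦ ?_
  exact (length_le_xCoord_add_yCoord p).trans_eq (by rw [hx, hy])

theorem finite_strictPaths (n : ℕ) : (strictPaths n).Finite :=
  (finite_schroderPaths 1 n).subset fun _ h ↦ h.1

/-! ### Strict paths -/

theorem mem_strictPaths_iff {j : ℕ} {p : List Step} : p ∈ strictPaths j ↔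
    xCoord p = j ∧ yCoord p = j ∧
      (p = [Step.D] ∨ ∀ q, q <+: p → q ≠ [] → q ≠ p → xCoord q < yCoord q) := by
  refine ⟨fun ⟨⟨hx, hy, _⟩, hp⟩ ↦ ⟨hx, by rwa [one_mul] at hy, hp⟩,
    fun ⟨hx, hy, hp⟩ ↦ ⟨⟨hx, by rwa [one_mul], fun q hq ↦ ?_⟩, hp⟩⟩
  rw [one_mul]
  rcases eq_or_ne q [] with rfl | hnil
  · simp
  rcases eq_or_ne q p with rfl | hne
  · omega
  rcases hp with rfl | hp
  · exact absurd ((prefix_concat_iff (l₂ := [])).1 hq) (by simp [hnil, hne])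
  · exact (hp q hq hnil hne).le

theorem concat_E_mem_strictPaths_iff {j : ℕ} {s : List Step} :
    s ++ [Step.E] ∈ strictPaths j ↔
      xCoord s + 1 = j ∧ yCoord s = j ∧ ∀ q, q <+: s → q ≠ [] → xCoord q < yCoord q := by
  have hD : s ++ [Step.E] ≠ [Step.D] := by simp [append_eq_singleton_iff]
  simp only [mem_strictPaths_iff, hD, false_or, forall_proper_prefix_concat_iff, xCoord_append,
    yCoord_append, xCoord_cons_E, yCoord_cons_E, xCoord_nil, yCoord_nil, zero_add, add_zero]

theorem exists_eq_concat_E {j : ℕ} {p : List Step} (hj : 0 < j) (hp : p ∈ strictPaths j)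
    (hD : p ≠ [Step.D]) : ∃ s, p = s ++ [Step.E] := by
  obtain ⟨hx, hy, hp⟩ := mem_strictPaths_iff.1 hp
  replace hp := hp.resolve_left hD
  rcases eq_nil_or_concat' p with rfl | ⟨s, e, rfl⟩
  · exact absurd hx hj.ne
  have hs : s ≠ [] → xCoord s < yCoord s := forall_proper_prefix_concat_iff.1 hp s prefix_rfl
  rcases eq_or_ne s [] with rfl | hne
  · cases e <;> simp_all
  · cases e
    · exact ⟨s, rfl⟩
    all_goals simp at hx hy; have := hs hne; omega

theorem N_cons_concat_E_mem_strictPaths_iff {j : ℕ} {p : List Step} :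
    Step.N :: (p ++ [Step.E]) ∈ strictPaths (j + 1) ↔ p ∈ schroderPaths 1 j := by
  rw [← cons_append, concat_E_mem_strictPaths_iff]
  simp only [schroderPaths, Set.mem_ofPred_eq, xCoord_cons_N, yCoord_cons_N, add_left_inj, one_mul]
  refine and_congr_right' (and_congr_right' ⟨fun h q hq ↦ ?_, fun h q hq hne ↦ ?_⟩)
  · simpa [Nat.lt_succ_iff] using h (Step.N :: q) (by simpa using hq) (by simp)
  · obtain ⟨q', rfl, hq'⟩ := (prefix_cons_iff.1 hq).resolve_left hne
    simpa [Nat.lt_succ_iff] using h q' hq'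

theorem exists_eq_N_cons_concat_E {j : ℕ} {p : List Step} (hj : 0 < j) (hp : p ∈ strictPaths j)
    (hD : p ≠ [Step.D]) : ∃ q, p = Step.N :: (q ++ [Step.E]) := by
  obtain ⟨s, rfl⟩ := exists_eq_concat_E hj hp hD
  obtain ⟨_, hy, hs⟩ := concat_E_mem_strictPaths_iff.1 hp
  cases s with
  | nil => exact absurd hy hj.ne
  | cons e s =>
    have he : xCoord [e] < yCoord [e] := hs [e] (by simp) (by simp)
    cases e <;> simp at he
    exact ⟨s, rfl⟩

theorem singleton_D_mem_strictPaths : [Step.D] ∈ strictPaths 1 :=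
  mem_strictPaths_iff.2 ⟨rfl, rfl, .inl rfl⟩

/-! ### Walking backwards to a line of slope one -/

/-- The steps `s` lead, walking backwards, from a point that lies `h` above a line of slope `1` to
the first point on that line. As in `cut`, the steps are listed in the order of the walk, that is,
in reverse. -/
def FirstHit (h : ℕ) (s : List Step) : Prop :=
  yCoord s = h + xCoord s ∧ ∀ t, t <+: s → t ≠ s → yCoord t < h + xCoord t

theorem firstHit_zero {s : List Step} : FirstHit 0 s ↔ s = [] := by
  refine ⟨fun ⟨_, hs⟩ ↦ ?_, ?_⟩
  · by_contra hne
    exact lt_irrefl _ (hs [] nil_prefix (Ne.symm hne))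
  · rintro rfl
    exact ⟨rfl, fun t ht hne ↦ absurd (prefix_nil.1 ht) hne⟩

theorem not_firstHit_succ_nil (h : ℕ) : ¬ FirstHit (h + 1) [] := fun ⟨hy, _⟩ ↦ by
  simp at hy

theorem firstHit_succ_cons {h k : ℕ} {e : Step} {s : List Step}
    (hk : h + 1 + xCoord [e] = k + yCoord [e]) : FirstHit (h + 1) (e :: s) ↔ FirstHit k s := by
  have hx (t : List Step) : xCoord (e :: t) = xCoord [e] + xCoord t := xCoord_append [e] t
  have hy (t : List Step) : yCoord (e :: t) = yCoord [e] + yCoord t := yCoord_append [e] t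
  simp only [FirstHit, prefix_cons_iff, forall_eq_or_imp, forall_exists_index, and_imp]
  constructor
  · rintro ⟨htot, -, hlt⟩
    refine ⟨by rw [hx, hy] at htot; omega, fun t ht hne ↦ ?_⟩
    have := hlt _ t rfl ht (by simpa using hne)
    rw [hx, hy] at this
    omega
  · rintro ⟨htot, hlt⟩
    refine ⟨by rw [hx, hy]; omega, by simp, ?_⟩
    rintro _ t rfl ht hne
    have := hlt t ht (by simpa using hne)
    rw [hx, hy]
    omega

theorem FirstHit.cut_append {h : ℕ} {s : List Step} (hs : FirstHit h s) (r : List Step) :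
    cut h (s ++ r) = (s, r) := by
  induction s generalizing h with
  | nil =>
    cases h with
    | zero => simp [cut]
    | succ h => exact absurd hs (not_firstHit_succ_nil h)
  | cons e s ih =>
    cases h with
    | zero => simp [firstHit_zero] at hs
    | succ h =>
      cases e <;> simp only [cons_append, cut]
      · rw [ih ((firstHit_succ_cons rfl).1 hs)]
      · rw [ih ((firstHit_succ_cons rfl).1 hs)]
      · rw [ih ((firstHit_succ_cons rfl).1 hs)]

theorem exists_firstHit_append_eq {h : ℕ} {r : List Step} (hr : h + xCoord r ≤ yCoord r) :
    ∃ s t, FirstHit h s ∧ s ++ t = r := by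
  induction r generalizing h with
  | nil =>
    obtain rfl : h = 0 := by simpa using hr
    exact ⟨[], [], firstHit_zero.2 rfl, rfl⟩
  | cons e r ih =>
    cases h with
    | zero => exact ⟨[], e :: r, firstHit_zero.2 rfl, rfl⟩
    | succ h =>
      obtain ⟨k, hk⟩ : ∃ k, h + 1 + xCoord [e] = k + yCoord [e] := by
        cases e <;> simp
      have hx : xCoord (e :: r) = xCoord [e] + xCoord r := xCoord_append [e] r
      have hy : yCoord (e :: r) = yCoord [e] + yCoord r := yCoord_append [e] r
      obtain ⟨s, t, hs, rfl⟩ := ih (h := k) (by omega)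
      exact ⟨e :: s, t, (firstHit_succ_cons hk).2 hs, rfl⟩

theorem concat_E_mem_strictPaths_iff_firstHit {s : List Step} :
    s ++ [Step.E] ∈ strictPaths (xCoord s + 1) ↔ FirstHit 1 s.reverse := by
  rw [concat_E_mem_strictPaths_iff, FirstHit, xCoord_reverse, yCoord_reverse, add_comm 1]
  simp only [true_and]
  refine and_congr_right fun hy ↦ ⟨fun hs t ⟨q, hqt⟩ hne ↦ ?_, fun hs q ⟨t, hqt⟩ hne ↦ ?_⟩
  · have hlt := hs q.reverse ⟨t.reverse, by simpa using congrArg reverse hqt⟩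
      fun hq ↦ hne (by simpa [reverse_eq_nil_iff.1 hq] using hqt)
    rw [← xCoord_reverse s, ← yCoord_reverse s, ← hqt] at hy
    simp only [xCoord_append, yCoord_append, xCoord_reverse, yCoord_reverse] at hy hlt
    omega
  · have hlt := hs t.reverse ⟨q.reverse, by simpa using congrArg reverse hqt⟩
      fun ht ↦ hne (by simpa [reverse_inj.1 ht] using hqt)
    rw [← hqt] at hy
    simp only [xCoord_append, yCoord_append, xCoord_reverse, yCoord_reverse] at hy hlt
    omega

theorem xi_append_strictPath {a j : ℕ} {p : List Step} (hj : 0 < j) (hp : p ∈ strictPaths j)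
    (q : List Step) :
    xi (a + 1) (q ++ p) = (block a j ++ (xi (a + 1) q).1, p :: (xi (a + 1) q).2) := by
  obtain rfl : xCoord p = j := hp.1.1
  by_cases hD : p = [Step.D]
  · simp [hD, xi, xiRev, block]
  · obtain ⟨s, rfl⟩ := exists_eq_concat_E hj hp hD
    rw [xCoord_append] at hp
    have hcut := (concat_E_mem_strictPaths_iff_firstHit.1 hp).cut_append q.reverse
    simp [xi, xiRev, block, hcut]

/-! ### Pieces -/

/-- The paths that can color an ascent. A positive extent has to be asked for because
`strictPaths 0` consists of the empty path. -/
abbrev StrictPath : Type := {p : List Step // 0 < xCoord p ∧ p ∈ strictPaths (xCoord p)}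

/-- The parts into which `ξ` cuts a path: a strict path, or a single step `N`, encoded as `none`. -/
abbrev Piece : Type := Option StrictPath

/-- The steps of a piece. -/
def piecePath : Piece → List Step
  | none => [Step.N]
  | some p => p

/-- The path made up of the given pieces, which are listed from its end to its start. -/
def pathOf (ts : List Piece) : List Step := ts.reverse.flatMap piecePath

/-- The word that `ξ` writes, for the slope `a + 1`, while it walks along a piece. -/
def pieceWord (a : ℕ) : Piece → List DyckStep
  | none => [DyckStep.D]
  | some p => block a (xCoord p.1)

/-- The word that `ξ` writes, for the slope `a + 1`, while it walks along a list of pieces. -/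
def wordOf (a : ℕ) (ts : List Piece) : List DyckStep := ts.flatMap (pieceWord a)

/-- The colors that `ξ` uses on a list of pieces. -/
def colorsOf (ts : List Piece) : List (List Step) := ts.reduceOption.map Subtype.val

/-- The colored word that encodes a list of pieces for the slope `a + 1`. -/
def codeOf (a : ℕ) (ts : List Piece) : List DyckStep × List (List Step) :=
  (wordOf a ts, colorsOf ts)

@[simp] theorem pathOf_nil : pathOf [] = [] := rfl

@[simp] theorem pathOf_cons (t : Piece) (ts : List Piece) :
    pathOf (t :: ts) = pathOf ts ++ piecePath t := by
  simp [pathOf]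

@[simp] theorem pathOf_append (ts us : List Piece) :
    pathOf (ts ++ us) = pathOf us ++ pathOf ts := by
  simp [pathOf]

@[simp] theorem wordOf_nil (a : ℕ) : wordOf a [] = [] := rfl

@[simp] theorem wordOf_cons (a : ℕ) (t : Piece) (ts : List Piece) :
    wordOf a (t :: ts) = pieceWord a t ++ wordOf a ts := rfl

@[simp] theorem colorsOf_nil : colorsOf [] = [] := rfl

@[simp] theorem colorsOf_none_cons (ts : List Piece) : colorsOf (none :: ts) = colorsOf ts := rfl

@[simp] theorem colorsOf_some_cons (p : StrictPath) (ts : List Piece) :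
    colorsOf (some p :: ts) = p.1 :: colorsOf ts := rfl

theorem xi_pathOf (a : ℕ) (ts : List Piece) : xi (a + 1) (pathOf ts) = codeOf a ts := by
  induction ts with
  | nil => simp [xi, xiRev, codeOf]
  | cons t ts ih =>
    rcases t with - | p
    · have hN : xi (a + 1) (pathOf ts ++ [Step.N]) =
          (DyckStep.D :: (xi (a + 1) (pathOf ts)).1, (xi (a + 1) (pathOf ts)).2) := by
        simp [xi, xiRev]
      rw [pathOf_cons, piecePath, hN, ih]
      rfl
    · rw [pathOf_cons, piecePath, xi_append_strictPath p.2.1 p.2.2, ih]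
      rfl

theorem exists_strictPath_append_concat_E_eq {p : List Step}
    (hp : xCoord p + 1 ≤ yCoord p) :
    ∃ q s, q ++ s = p ∧ s ++ [Step.E] ∈ strictPaths (xCoord s + 1) := by
  obtain ⟨s, t, hs, hst⟩ := exists_firstHit_append_eq (h := 1) (r := p.reverse)
    (by rw [xCoord_reverse, yCoord_reverse]; omega)
  refine ⟨t.reverse, s.reverse, by rw [← reverse_append, hst, reverse_reverse], ?_⟩
  rwa [concat_E_mem_strictPaths_iff_firstHit, reverse_reverse]

theorem exists_pathOf_eq {p : List Step} (hp : ∀ q, q <+: p → xCoord q ≤ yCoord q) :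
    ∃ ts, pathOf ts = p := by
  induction hlen : p.length using Nat.strong_induction_on generalizing p with
  | _ m ih =>
    subst hlen
    have of_append {q s : List Step} (hqs : q ++ s = p) (hs : s ≠ []) : ∃ ts, pathOf ts = q :=
      ih q.length (by simpa [← hqs] using length_pos_iff.2 hs)
        (fun r hr ↦ hp r (hr.trans ⟨s, hqs⟩)) rfl
    rcases eq_nil_or_concat' p with rfl | ⟨q, e, rfl⟩
    · exact ⟨[], rfl⟩
    cases e with
    | E =>
      have hq : xCoord q + 1 ≤ yCoord q := by simpa using hp _ prefix_rfl
      obtain ⟨r, s, rfl, hs⟩ := exists_strictPath_append_concat_E_eq hq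
      obtain ⟨ts, rfl⟩ := of_append (append_assoc r s [Step.E]).symm (by simp)
      exact ⟨some ⟨s ++ [Step.E], by simp, by simpa using hs⟩ :: ts, by simp [piecePath]⟩
    | N =>
      obtain ⟨ts, rfl⟩ := of_append rfl (by simp)
      exact ⟨none :: ts, by simp [piecePath]⟩
    | D =>
      obtain ⟨ts, rfl⟩ := of_append rfl (by simp)
      exact ⟨some ⟨[Step.D], by simp, singleton_D_mem_strictPaths⟩ :: ts, by simp [piecePath]⟩

theorem exists_block_eq_U_cons (a : ℕ) {j : ℕ} (hj : 0 < j) :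
    ∃ w, block a j = DyckStep.U :: w := by
  obtain ⟨m, hm⟩ := Nat.exists_eq_succ_of_ne_zero (mul_pos a.succ_pos hj).ne'
  exact ⟨_, by rw [block, hm, replicate_succ, cons_append]⟩

theorem codeOf_injective (a : ℕ) : Function.Injective (codeOf a) := by
  intro ts us h
  induction ts generalizing us with
  | nil =>
    rcases us with - | ⟨- | p, us⟩
    · rfl
    · simp [codeOf, pieceWord] at h
    · simp [codeOf] at h
  | cons t ts ih =>
    obtain ⟨hw, hc⟩ := Prod.ext_iff.1 h
    rcases us with - | ⟨u, us⟩
    · rcases t with - | p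
      · simp [codeOf, pieceWord] at h
      · simp [codeOf] at h
    rcases t with - | p <;> rcases u with - | q
    · have h' : codeOf a ts = codeOf a us := by
        simpa [codeOf, pieceWord] using h
      rw [ih h']
    · obtain ⟨w, hw'⟩ := exists_block_eq_U_cons a q.2.1
      simp [codeOf, pieceWord, hw'] at h
    · obtain ⟨w, hw'⟩ := exists_block_eq_U_cons a p.2.1
      simp [codeOf, pieceWord, hw'] at h
    · simp only [codeOf, colorsOf_some_cons, cons.injEq] at hc
      obtain ⟨hpq, hc⟩ := hc
      obtain rfl : p = q := Subtype.ext hpq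
      have h' : codeOf a ts = codeOf a us := Prod.ext (append_cancel_left hw) hc
      rw [ih h']

theorem pathOf_injective : Function.Injective pathOf :=
  .of_comp (f := xi 1) <| by simpa only [Function.comp_def, xi_pathOf 0] using codeOf_injective 0

/-! ### Heights -/

/-- The height `y - α x` of the endpoint of a path above the line `y = α x`. -/
def height (α : ℕ) (p : List Step) : ℤ := yCoord p - α * xCoord p

/-- The excess of the number of `u`'s over the number of `d`'s: the words of excess zero all of
whose prefixes have nonnegative excess are the Dyck words. -/
def dyckHeight (w : List DyckStep) : ℤ := w.count DyckStep.U - w.count DyckStep.D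

theorem height_append (α : ℕ) (p q : List Step) :
    height α (p ++ q) = height α p + height α q := by
  simp only [height, xCoord_append, yCoord_append, Nat.cast_add]
  ring

theorem dyckHeight_append (w v : List DyckStep) :
    dyckHeight (w ++ v) = dyckHeight w + dyckHeight v := by
  simp only [dyckHeight, count_append, Nat.cast_add]
  ring

theorem mem_schroderPaths_iff {α n : ℕ} {p : List Step} : p ∈ schroderPaths α n ↔
    xCoord p = n ∧ height α p = 0 ∧ ∀ q, q <+: p → 0 ≤ height α q := by
  simp only [height, sub_nonneg, sub_eq_zero]
  constructor
  · rintro ⟨rfl, hy, hp⟩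
    exact ⟨rfl, mod_cast hy, mod_cast hp⟩
  · rintro ⟨rfl, hy, hp⟩
    exact ⟨rfl, mod_cast hy, mod_cast hp⟩

theorem xCoord_le_yCoord_of_mem_schroderPaths {a n : ℕ} {p q : List Step}
    (hp : p ∈ schroderPaths (a + 1) n) (hq : q <+: p) : xCoord q ≤ yCoord q :=
  (Nat.le_mul_of_pos_left _ a.succ_pos).trans (hp.2.2 q hq)

theorem count_U_wordOf (a : ℕ) (ts : List Piece) :
    (wordOf a ts).count DyckStep.U = (a + 1) * xCoord (pathOf ts) := by
  induction ts with
  | nil => simp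
  | cons t ts ih =>
    rcases t with - | p
    · simp [ih, pieceWord, piecePath]
    · simp [ih, pieceWord, piecePath, block, count_replicate]
      ring

theorem count_D_wordOf (a : ℕ) (ts : List Piece) :
    (wordOf a ts).count DyckStep.D = yCoord (pathOf ts) := by
  induction ts with
  | nil => simp
  | cons t ts ih =>
    rcases t with - | ⟨p, _, hp⟩
    · simp [ih, pieceWord, piecePath]
    · have hy : yCoord p = xCoord p := (mem_strictPaths_iff.1 hp).2.1
      simp [ih, pieceWord, piecePath, block, count_replicate, hy, add_comm]

theorem dyckHeight_wordOf (a : ℕ) (ts : List Piece) :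
    dyckHeight (wordOf a ts) = -height (a + 1) (pathOf ts) := by
  simp only [dyckHeight, height, count_U_wordOf, count_D_wordOf]
  push_cast
  ring

theorem height_nonneg_or_le_of_prefix_piecePath (a : ℕ) (t : Piece) {q : List Step}
    (hq : q <+: piecePath t) :
    0 ≤ height (a + 1) q ∨ height (a + 1) (piecePath t) ≤ height (a + 1) q := by
  rcases t with - | ⟨p, _, hp⟩
  · have hxq : xCoord q ≤ xCoord [Step.N] := xCoord_le_of_sublist hq.sublist
    left
    simp only [xCoord_cons_N, xCoord_nil, nonpos_iff_eq_zero] at hxq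
    simp [height, hxq]
  · right
    have hxy : xCoord q ≤ yCoord q := by simpa using hp.1.2.2 q hq
    have hxq : xCoord q ≤ xCoord p := xCoord_le_of_sublist hq.sublist
    have hyp : yCoord p = xCoord p := (mem_strictPaths_iff.1 hp).2.1
    have hmul : (a : ℤ) * xCoord q ≤ a * xCoord p := mod_cast Nat.mul_le_mul_left a hxq
    simp only [height, piecePath, hyp]
    push_cast
    linarith

theorem dyckHeight_nonneg_or_le_of_prefix_replicate (m k : ℕ) {w : List DyckStep}
    (hw : w <+: replicate m DyckStep.U ++ replicate k DyckStep.D) :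
    0 ≤ dyckHeight w ∨
      dyckHeight (replicate m DyckStep.U ++ replicate k DyckStep.D) ≤ dyckHeight w := by
  revert w
  rw [forall_prefix_append_iff]
  refine ⟨fun w hw ↦ .inl ?_, fun w hw ↦ .inr ?_⟩
  · obtain ⟨i, -, rfl⟩ : ∃ i ≤ m, w = replicate i DyckStep.U := ⟨_, prefix_replicate_iff.1 hw⟩
    simp [dyckHeight, count_replicate]
  · obtain ⟨i, hik, rfl⟩ : ∃ i ≤ k, w = replicate i DyckStep.D := ⟨_, prefix_replicate_iff.1 hw⟩
    simp only [dyckHeight, count_append, count_replicate_self, count_replicate, Nat.cast_add]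
    simp only [reduceCtorEq, beq_iff_eq, if_false]
    omega

theorem forall_prefix_pathOf_iff (a : ℕ) (ts : List Piece) :
    (∀ q, q <+: pathOf ts → 0 ≤ height (a + 1) q) ↔
      ∀ us, us <:+ ts → 0 ≤ height (a + 1) (pathOf us) := by
  rw [pathOf, forall_prefix_flatMap_nonneg_iff (height_append _)
    fun t _ ↦ height_nonneg_or_le_of_prefix_piecePath a t, reverse_surjective.forall]
  simp only [reverse_prefix, pathOf]

theorem forall_prefix_wordOf_iff (a : ℕ) (ts : List Piece) :
    (∀ w, w <+: wordOf a ts → 0 ≤ dyckHeight w) ↔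
      ∀ us, us <+: ts → 0 ≤ dyckHeight (wordOf a us) := by
  refine forall_prefix_flatMap_nonneg_iff dyckHeight_append (fun t _ ht ↦ ?_) ts
  cases t with
  | none => exact dyckHeight_nonneg_or_le_of_prefix_replicate 0 1 ht
  | some p => exact dyckHeight_nonneg_or_le_of_prefix_replicate _ _ ht

theorem forall_prefix_pathOf_iff_forall_prefix_wordOf {a : ℕ} {ts : List Piece}
    (hts : height (a + 1) (pathOf ts) = 0) :
    (∀ q, q <+: pathOf ts → 0 ≤ height (a + 1) q) ↔
      ∀ w, w <+: wordOf a ts → 0 ≤ dyckHeight w := by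
  have height_eq {us vs : List Piece} (h : vs ++ us = ts) :
      height (a + 1) (pathOf us) = dyckHeight (wordOf a vs) := by
    rw [← h, pathOf_append, height_append] at hts
    rw [dyckHeight_wordOf]
    exact eq_neg_of_add_eq_zero_left hts
  rw [forall_prefix_pathOf_iff, forall_prefix_wordOf_iff]
  exact ⟨fun h vs ⟨us, hus⟩ ↦ height_eq hus ▸ h us ⟨vs, hus⟩,
    fun h us ⟨vs, hvs⟩ ↦ height_eq hvs ▸ h vs ⟨us, hvs⟩⟩

/-! ### Colored Dyck words -/

theorem exists_dyckWord_iff {w : List DyckStep} {m : ℕ} :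
    (∃ W : DyckWord, W.toList = w ∧ W.semilength = m) ↔
      w.count DyckStep.U = m ∧ dyckHeight w = 0 ∧ ∀ v, v <+: w → 0 ≤ dyckHeight v := by
  simp only [dyckHeight, sub_eq_zero, sub_nonneg, Nat.cast_inj, Nat.cast_le]
  constructor
  · rintro ⟨W, rfl, rfl⟩
    refine ⟨rfl, W.count_U_eq_count_D, fun v hv ↦ ?_⟩
    rw [prefix_iff_eq_take.1 hv]
    exact W.count_D_le_count_U _
  · rintro ⟨rfl, hUD, hw⟩
    exact ⟨⟨w, hUD, fun i ↦ hw _ (take_prefix i w)⟩, rfl, rfl⟩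

@[simp] theorem ascentLengths_nil : ascentLengths [] = [] := by simp [ascentLengths]

@[simp] theorem ascentLengths_cons_D (w : List DyckStep) :
    ascentLengths (DyckStep.D :: w) = ascentLengths w := by
  have hsplit := splitOn_append_cons_self_of_not_mem (a := DyckStep.D) (xs := []) (by simp) w
  rw [nil_append] at hsplit
  simp [ascentLengths, hsplit]

theorem ascentLengths_replicate_D_append (j : ℕ) (w : List DyckStep) :
    ascentLengths (replicate j DyckStep.D ++ w) = ascentLengths w := by
  induction j with
  | zero => simp
  | succ j ih => rw [replicate_succ, cons_append, ascentLengths_cons_D, ih]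

theorem ascentLengths_block_append (a : ℕ) {j : ℕ} (hj : 0 < j) (w : List DyckStep) :
    ascentLengths (block a j ++ w) = (a + 1) * j :: ascentLengths w := by
  obtain ⟨j, rfl⟩ := Nat.exists_eq_add_of_le' hj
  have hsplit := splitOn_append_cons_self_of_not_mem (a := DyckStep.D)
    (xs := replicate ((a + 1) * (j + 1)) DyckStep.U) (by simp) (replicate j DyckStep.D ++ w)
  rw [block, replicate_succ (n := j), append_assoc, cons_append,
    ← ascentLengths_replicate_D_append j w, ascentLengths, hsplit]
  simp [ascentLengths]

theorem ascentLengths_wordOf (a : ℕ) (ts : List Piece) :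
    ascentLengths (wordOf a ts) = (colorsOf ts).map fun p ↦ (a + 1) * xCoord p := by
  induction ts with
  | nil => simp
  | cons t ts ih =>
    rcases t with - | p
    · simpa [pieceWord] using ih
    · simpa [pieceWord, ascentLengths_block_append a p.2.1] using ih

theorem forall₂_ascentLengths_wordOf (a : ℕ) (ts : List Piece) :
    Forall₂ (fun l p ↦ ∃ j, l = (a + 1) * j ∧ p ∈ strictPaths j)
      (ascentLengths (wordOf a ts)) (colorsOf ts) := by
  rw [ascentLengths_wordOf, forall₂_map_left_iff, forall₂_same]
  intro p hp
  obtain ⟨⟨p, hpos, hstrict⟩, -, rfl⟩ := mem_map.1 hp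
  exact ⟨xCoord p, rfl, hstrict⟩

theorem xCoord_piecePath_le {t : Piece} {ts : List Piece} (ht : t ∈ ts) :
    xCoord (piecePath t) ≤ xCoord (pathOf ts) :=
  xCoord_le_of_sublist <| sublist_flatten_of_mem (mem_map_of_mem (mem_reverse.2 ht))

theorem wordOf_mem_blockDyckWords_iff {a n : ℕ} {ts : List Piece} :
    wordOf a ts ∈ blockDyckWords a n ↔
      xCoord (pathOf ts) = n ∧ dyckHeight (wordOf a ts) = 0 ∧
        ∀ w, w <+: wordOf a ts → 0 ≤ dyckHeight w := by
  have hU : (wordOf a ts).count DyckStep.U = (a + 1) * n ↔ xCoord (pathOf ts) = n := by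
    rw [count_U_wordOf, Nat.mul_left_cancel_iff a.succ_pos]
  rw [← hU, ← exists_dyckWord_iff]
  refine ⟨fun h ↦ h.1, fun h ↦ ⟨h, ts.map (pieceWord a), ?_, flatMap_def⟩⟩
  obtain rfl := hU.1 (exists_dyckWord_iff.1 h).1
  simp only [mem_map, forall_exists_index, and_imp, forall_apply_eq_imp_iff₂]
  rintro (- | p) hp
  · exact .inl rfl
  · exact .inr ⟨xCoord p.1, p.2.1, xCoord_piecePath_le hp, rfl⟩

theorem pathOf_mem_schroderPaths_iff {a n : ℕ} {ts : List Piece} :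
    pathOf ts ∈ schroderPaths (a + 1) n ↔ codeOf a ts ∈ coloredDyckWords strictPaths a n := by
  have hcode : codeOf a ts ∈ coloredDyckWords strictPaths a n ↔
      wordOf a ts ∈ blockDyckWords a n := and_iff_left (forall₂_ascentLengths_wordOf a ts)
  rw [hcode, mem_schroderPaths_iff, wordOf_mem_blockDyckWords_iff, dyckHeight_wordOf, neg_eq_zero]
  exact and_congr_right' (and_congr_right forall_prefix_pathOf_iff_forall_prefix_wordOf)

theorem exists_codeOf_eq_of_forall₂ {a : ℕ} {bs : List (List DyckStep)} {cs : List (List Step)}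
    (hbs : ∀ b ∈ bs, b = [DyckStep.D] ∨ ∃ j, 1 ≤ j ∧ b = block a j)
    (hcs : Forall₂ (fun l p ↦ ∃ j, l = (a + 1) * j ∧ p ∈ strictPaths j)
      (ascentLengths bs.flatten) cs) : ∃ ts, codeOf a ts = (bs.flatten, cs) := by
  induction bs generalizing cs with
  | nil =>
    obtain rfl : cs = [] := by simpa using hcs
    exact ⟨[], rfl⟩
  | cons b bs ih =>
    rw [forall_mem_cons] at hbs
    rw [flatten_cons] at hcs
    obtain ⟨rfl | ⟨j, hj, rfl⟩, hbs⟩ := hbs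
    · rw [singleton_append, ascentLengths_cons_D] at hcs
      obtain ⟨ts, hts⟩ := ih hbs hcs
      obtain ⟨hw, hc⟩ := Prod.ext_iff.1 hts
      exact ⟨none :: ts, Prod.ext (congrArg (DyckStep.D :: ·) hw) hc⟩
    · rw [ascentLengths_block_append a hj, forall₂_cons_left_iff] at hcs
      obtain ⟨p, cs, ⟨i, hij, hp⟩, hcs, rfl⟩ := hcs
      obtain rfl : j = i := Nat.eq_of_mul_eq_mul_left a.succ_pos hij
      obtain ⟨ts, hts⟩ := ih hbs hcs
      obtain ⟨hw, hc⟩ := Prod.ext_iff.1 hts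
      obtain rfl : xCoord p = j := hp.1.1
      exact ⟨some ⟨p, hj, hp⟩ :: ts, Prod.ext (congrArg (block a (xCoord p) ++ ·) hw)
        (congrArg (p :: ·) hc)⟩

theorem coloredDyckWords_subset_range_codeOf (a n : ℕ) :
    coloredDyckWords strictPaths a n ⊆ Set.range (codeOf a) := by
  rintro ⟨_, cs⟩ ⟨⟨-, bs, hbs, rfl⟩, hcs⟩
  exact exists_codeOf_eq_of_forall₂
    (fun b hb ↦ (hbs b hb).imp_right fun ⟨j, hj, _, hbj⟩ ↦ ⟨j, hj, hbj⟩) hcs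

theorem schroderPaths_subset_range_pathOf (a n : ℕ) :
    schroderPaths (a + 1) n ⊆ Set.range pathOf := fun _ hp ↦
  exists_pathOf_eq fun _ hq ↦ xCoord_le_yCoord_of_mem_schroderPaths hp hq

theorem bijOn_xi (a n : ℕ) :
    Set.BijOn (xi (a + 1)) (schroderPaths (a + 1) n) (coloredDyckWords strictPaths a n) := by
  have hpre : pathOf ⁻¹' schroderPaths (a + 1) n = codeOf a ⁻¹' coloredDyckWords strictPaths a n :=
    Set.ext fun _ ↦ pathOf_mem_schroderPaths_iff
  have hcomp : xi (a + 1) ∘ pathOf = codeOf a := funext (xi_pathOf a)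
  rw [← Set.image_preimage_eq_of_subset (schroderPaths_subset_range_pathOf a n),
    ← Set.bijOn_comp_iff pathOf_injective.injOn, hpre, hcomp]
  simpa only [Set.image_preimage_eq_of_subset (coloredDyckWords_subset_range_codeOf a n)] using
    (codeOf_injective a).bijOn_image (s := codeOf a ⁻¹' coloredDyckWords strictPaths a n)

/-! ### Replacing the colors -/

theorem bijOn_zipWith_forall₂ {β γ δ : Type*} {R : β → γ → Prop} {S : β → δ → Prop}
    {f : β → γ → δ} (hf : ∀ b, Set.BijOn (f b) {c | R b c} {d | S b d}) (bs : List β) :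
    Set.BijOn (zipWith f bs) {cs | Forall₂ R bs cs} {ds | Forall₂ S bs ds} := by
  induction bs with
  | nil => simp [Set.BijOn, Set.MapsTo, Set.SurjOn]
  | cons b bs ih =>
    refine ⟨?_, ?_, ?_⟩
    · rintro _ (- | ⟨hc, hcs⟩)
      exact .cons ((hf b).mapsTo hc) (ih.mapsTo hcs)
    · rintro _ (- | ⟨hc, hcs⟩) _ (- | ⟨hc', hcs'⟩) h
      rw [zipWith_cons_cons, zipWith_cons_cons, cons.injEq] at h
      exact congrArg₂ _ ((hf b).injOn hc hc' h.1) (ih.injOn hcs hcs' h.2)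
    · rintro _ (- | ⟨hd, hds⟩)
      obtain ⟨c, hc, rfl⟩ := (hf b).surjOn hd
      obtain ⟨cs, hcs, rfl⟩ := ih.surjOn hds
      exact ⟨c :: cs, .cons hc hcs, rfl⟩

theorem exists_bijOn_coloredDyckWords {κ ν : Type*} {C : ℕ → Set κ} {C' : ℕ → Set ν}
    (hC : ∀ j, ∃ f, Set.BijOn f (C j) (C' j)) (a n : ℕ) :
    ∃ F, Set.BijOn F (coloredDyckWords C a n) (coloredDyckWords C' a n) := by
  choose f hf using hC
  have hbij (w : List DyckStep) := bijOn_zipWith_forall₂ (f := fun l ↦ f (l / (a + 1)))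
    (R := fun l c ↦ ∃ j, l = (a + 1) * j ∧ c ∈ C j)
    (S := fun l c ↦ ∃ j, l = (a + 1) * j ∧ c ∈ C' j) (fun l ↦ ?_) (ascentLengths w)
  · refine ⟨fun q ↦ (q.1, zipWith (fun l ↦ f (l / (a + 1))) (ascentLengths q.1) q.2), ?_, ?_, ?_⟩
    · exact fun q ⟨hw, hc⟩ ↦ ⟨hw, (hbij q.1).mapsTo hc⟩
    · rintro ⟨w, cs⟩ ⟨_, hcs⟩ ⟨w', cs'⟩ ⟨_, hcs'⟩ h
      obtain ⟨rfl, h⟩ := Prod.ext_iff.1 h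
      exact congrArg _ ((hbij w).injOn hcs hcs' h)
    · rintro ⟨w, ds⟩ ⟨hw, hds⟩
      obtain ⟨cs, hcs, rfl⟩ := (hbij w).surjOn hds
      exact ⟨(w, cs), ⟨hw, hcs⟩, rfl⟩
  · by_cases hl : a + 1 ∣ l
    · obtain ⟨j, rfl⟩ := hl
      simpa [Nat.mul_div_cancel_left] using hf j
    · have hne (j : ℕ) : l ≠ (a + 1) * j := fun h ↦ hl ⟨j, h⟩
      simp [hne]

theorem exists_bijOn_numColoredDyckWords {κ : Type*} {C : ℕ → Set κ}
    (hC : ∀ j, (C j).Finite) (a n : ℕ) :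
    ∃ F, Set.BijOn F (coloredDyckWords C a n)
      (numColoredDyckWords (fun j ↦ (C j).ncard) a n) := by
  refine exists_bijOn_coloredDyckWords (fun j ↦ (hC j).exists_bijOn_of_encard_eq ?_) a n
  have hIio := (Set.finite_Iio (C j).ncard).cast_ncard_eq
  rw [Set.ncard_Iio_nat] at hIio
  exact (hC j).cast_ncard_eq.symm.trans hIio

/-! ### Enumeration -/

theorem strictPaths_succ (j : ℕ) : strictPaths (j + 1) =
    (if j = 0 then {[Step.D]} else ∅) ∪
      (fun p ↦ Step.N :: (p ++ [Step.E])) '' schroderPaths 1 j := by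
  ext p
  constructor
  · intro hp
    by_cases hD : p = [Step.D]
    · subst hD
      obtain rfl : 0 = j := Nat.succ.inj hp.1.1
      exact .inl rfl
    · obtain ⟨q, rfl⟩ := exists_eq_N_cons_concat_E j.succ_pos hp hD
      exact .inr ⟨q, N_cons_concat_E_mem_strictPaths_iff.1 hp, rfl⟩
  · rintro (hp | ⟨q, hq, rfl⟩)
    · split_ifs at hp with hj
      · rw [Set.mem_singleton_iff.1 hp, hj]
        exact singleton_D_mem_strictPaths
      · exact absurd hp (Set.notMem_empty _)
    · exact N_cons_concat_E_mem_strictPaths_iff.2 hq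

theorem sigma_succ (j : ℕ) :
    sigma (j + 1) = (if j = 0 then 1 else 0) + (schroderPaths 1 j).ncard := by
  have hinj : Function.Injective fun p : List Step ↦ Step.N :: (p ++ [Step.E]) := by
    intro p q h
    simpa using h
  have hdisj : Disjoint (if j = 0 then {[Step.D]} else ∅)
      ((fun p ↦ Step.N :: (p ++ [Step.E])) '' schroderPaths 1 j) := by
    rw [Set.disjoint_left]
    rintro p hp ⟨q, -, rfl⟩
    split_ifs at hp <;> simp at hp
  rw [sigma, strictPaths_succ, Set.ncard_union_eq hdisj (by split_ifs <;> simp)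
    ((finite_schroderPaths 1 j).image _), Set.ncard_image_of_injective _ hinj]
  split_ifs <;> simp

theorem append_mem_schroderPaths {α i j : ℕ} {p q : List Step} (hp : p ∈ schroderPaths α i)
    (hq : q ∈ schroderPaths α j) : p ++ q ∈ schroderPaths α (i + j) := by
  rw [mem_schroderPaths_iff] at hp hq ⊢
  obtain ⟨hpx, hph, hp⟩ := hp
  obtain ⟨hqx, hqh, hq⟩ := hq
  refine ⟨by rw [xCoord_append, hpx, hqx], by rw [height_append, hph, hqh, add_zero],
    forall_prefix_append_iff.2 ⟨hp, fun r hr ↦ ?_⟩⟩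
  rw [height_append, hph, zero_add]
  exact hq r hr

theorem append_strictPath_inj {p p' q q' : List Step} {i i' j j' : ℕ} (hj : 0 < j) (hj' : 0 < j')
    (hp : p ∈ schroderPaths 1 i) (hp' : p' ∈ schroderPaths 1 i') (hq : q ∈ strictPaths j)
    (hq' : q' ∈ strictPaths j') (h : p ++ q = p' ++ q') : p = p' ∧ q = q' := by
  obtain ⟨ts, rfl⟩ := schroderPaths_subset_range_pathOf 0 i hp
  obtain ⟨ts', rfl⟩ := schroderPaths_subset_range_pathOf 0 i' hp'
  obtain rfl : xCoord q = j := hq.1.1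
  obtain rfl : xCoord q' = j' := hq'.1.1
  have hts : some ⟨q, hj, hq⟩ :: ts = some ⟨q', hj', hq'⟩ :: ts' :=
    pathOf_injective (by simpa [piecePath] using h)
  simp only [cons.injEq, Option.some.injEq, Subtype.mk.injEq] at hts
  exact ⟨congrArg pathOf hts.2, hts.1⟩

theorem exists_append_strictPath_eq {n : ℕ} {p : List Step} (hp : p ∈ schroderPaths 1 n)
    (hn : 0 < n) : ∃ q s i, i < n ∧ q ∈ schroderPaths 1 i ∧ s ∈ strictPaths (n - i) ∧
      q ++ s = p := by
  obtain ⟨ts, rfl⟩ := schroderPaths_subset_range_pathOf 0 n hp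
  obtain ⟨hx, hy, habove⟩ := hp
  cases ts with
  | nil => exact absurd hx hn.ne
  | cons t ts =>
    rw [pathOf_cons] at hx hy habove
    have hts := (forall_prefix_append_iff.1 habove).1
    have hle := hts _ prefix_rfl
    rw [xCoord_append] at hx
    rw [yCoord_append] at hy
    rcases t with - | ⟨s, hpos, hs⟩
    · simp [piecePath] at hx hy
      omega
    · have hys : yCoord s = xCoord s := (mem_strictPaths_iff.1 hs).2.1
      simp only [piecePath] at hx hy
      refine ⟨pathOf ts, s, xCoord (pathOf ts), by omega, ⟨rfl, by omega, hts⟩, ?_,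
        by rw [pathOf_cons, piecePath]⟩
      rwa [← hx, Nat.add_sub_cancel_left]

theorem bijOn_append (n : ℕ) : Set.BijOn (fun x : List Step × List Step ↦ x.1 ++ x.2)
    (⋃ i : Fin (n + 1), schroderPaths 1 i ×ˢ strictPaths (n - i + 1))
    (schroderPaths 1 (n + 1)) := by
  refine ⟨?_, ?_, ?_⟩
  · rintro ⟨p, q⟩ h
    obtain ⟨i, hp, hq⟩ := Set.mem_iUnion.1 h
    have hi : i + (n - i + 1) = n + 1 := by omega
    exact hi ▸ append_mem_schroderPaths hp hq.1
  · rintro ⟨p, q⟩ h ⟨p', q'⟩ h' heq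
    obtain ⟨i, hp, hq⟩ := Set.mem_iUnion.1 h
    obtain ⟨i', hp', hq'⟩ := Set.mem_iUnion.1 h'
    obtain ⟨rfl, rfl⟩ := append_strictPath_inj (Nat.succ_pos _) (Nat.succ_pos _) hp hp' hq hq' heq
    rfl
  · intro p hp
    obtain ⟨q, s, i, hi, hq, hs, rfl⟩ := exists_append_strictPath_eq hp n.succ_pos
    refine ⟨(q, s), Set.mem_iUnion.2 ⟨⟨i, hi⟩, hq, ?_⟩, rfl⟩
    rwa [← Nat.sub_add_comm (Nat.le_of_lt_succ hi)]

theorem ncard_schroderPaths_one_succ (n : ℕ) : (schroderPaths 1 (n + 1)).ncard =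
    ∑ i : Fin (n + 1), (schroderPaths 1 i).ncard * sigma (n - i + 1) := by
  have hdisj : Pairwise (Function.onFun _root_.Disjoint fun i : Fin (n + 1) ↦
      schroderPaths 1 i ×ˢ strictPaths (n - i + 1)) := fun i i' hne ↦
    Set.disjoint_left.2 fun _ hp hp' ↦ hne (Fin.ext (hp.1.1.symm.trans hp'.1.1))
  rw [← (bijOn_append n).ncard_eq, Set.ncard_iUnion_of_finite
    (fun i : Fin (n + 1) ↦ (finite_schroderPaths 1 i).prod (finite_strictPaths (n - i + 1))) hdisj,
    finsum_eq_sum_of_fintype]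
  simp only [Set.ncard_prod, sigma]

theorem schroderPaths_zero (α : ℕ) : schroderPaths α 0 = {[]} := by
  ext p
  constructor
  · rintro ⟨hx, hy, -⟩
    have hlen := length_le_xCoord_add_yCoord p
    rw [hx, hy] at hlen
    simpa using hlen
  · rintro rfl
    exact ⟨rfl, rfl, fun q hq ↦ by simp [prefix_nil.1 hq]⟩

theorem ncard_schroderPaths_one (n : ℕ) : (schroderPaths 1 n).ncard = n.largeSchroder := by
  induction n using Nat.strong_induction_on with
  | _ n ih =>
  cases n with
  | zero => simp [schroderPaths_zero]
  | succ n =>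
    have hterm (i : Fin (n + 1)) : (schroderPaths 1 i).ncard * sigma (n - i + 1) =
        (if i = Fin.last n then n.largeSchroder else 0) +
          Nat.largeSchroder i * Nat.largeSchroder (n - i) := by
      have hi : n - i = 0 ↔ i = Fin.last n := by
        rw [Fin.ext_iff, Fin.val_last]
        omega
      rw [sigma_succ, ih i i.2, ih (n - i) (by omega), mul_add]
      by_cases h : i = Fin.last n <;> simp [hi, h]
    rw [ncard_schroderPaths_one_succ, Nat.largeSchroder, Finset.sum_congr rfl fun i _ ↦ hterm i,
      Finset.sum_add_distrib, Finset.sum_ite_eq' Finset.univ, if_pos (Finset.mem_univ _)]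

theorem sigma_eq_two_mul_littleSchroder {j : ℕ} (hj : 1 ≤ j) :
    sigma j = 2 * littleSchroder (j - 1) := by
  obtain ⟨j, rfl⟩ := Nat.exists_eq_add_of_le' hj
  rw [sigma_succ, ncard_schroderPaths_one, littleSchroder, Nat.add_sub_cancel]
  by_cases h : j = 0
  · simp [h]
  · rw [Nat.two_mul_smallSchroder_succ h, if_neg h, zero_add]

end RationalSchroder

theorem mainTheorem2 (α n : ℕ) (hα : 1 ≤ α) :
    Set.BijOn (RationalSchroder.xi α) (RationalSchroder.schroderPaths α n)
      (RationalSchroder.coloredDyckWords RationalSchroder.strictPaths (α - 1) n) ∧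
    (RationalSchroder.schroderPaths α n).Finite ∧
    (RationalSchroder.numColoredDyckWords RationalSchroder.sigma (α - 1) n).Finite ∧
    (RationalSchroder.schroderPaths α n).ncard =
      (RationalSchroder.numColoredDyckWords RationalSchroder.sigma (α - 1) n).ncard ∧
    ∀ j : ℕ, 1 ≤ j → (RationalSchroder.strictPaths j).Finite ∧
      RationalSchroder.sigma j = 2 * RationalSchroder.littleSchroder (j - 1) := by
  obtain ⟨a, rfl⟩ := Nat.exists_eq_add_of_le' hα
  rw [Nat.add_sub_cancel]
  have hxi := RationalSchroder.bijOn_xi a n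
  have hfin := RationalSchroder.finite_schroderPaths (a + 1) n
  obtain ⟨F, hF⟩ :=
    RationalSchroder.exists_bijOn_numColoredDyckWords RationalSchroder.finite_strictPaths a n
  have hcomp := hF.comp hxi
  exact ⟨hxi, hfin, hcomp.finite_iff_finite.1 hfin, hcomp.ncard_eq, fun j hj ↦
    ⟨RationalSchroder.finite_strictPaths j, RationalSchroder.sigma_eq_two_mul_littleSchroder hj⟩⟩
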